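/- Let $T^2=\mathbb R^2/\mathbb Z^2$, and let $KI$ be the orientable twisted $I$-bundle over the Klein bottle, that is, the quotient of $T^2\times[0,1]$ by the free involution $(x,y,z)\mapsto(x+\tfrac12,-y,1-z)$. Its boundary is identified with $T^2$ through $p\mapsto[p,1]$, and $\alpha,\beta$ denote the generators of $\pi_1(T^2)$ given by the loops $t\mapsto (t,0)$ and $t\mapsto(0,t)$, $0\le t\le 1$. Let $A=\begin{pmatrix} r&s\\ t&u\end{pmatrix}\in GL_2(\mathbb Z)$, let $K_1I,K_2I$ be two copies of $KI$, with boundary generators $\alpha_i,\beta_i$, and let $\phi:\partial K_2I\to\partial K_1I$ be a homeomorphism such that $\phi_\#(\alpha_2)=r\alpha_1+s\beta_1$ and $\phi_\#(\beta_2)=t\alpha_1+u\beta_1$. The closed $3$-manifold $S_A=K_1I\cup_\phi K_2I$, in which each $x\in\partial K_2I$ is identified with $\phi(x)\in\partial K_1I$, is called a sapphire; it is called a Sol sapphire if $rstu\neq0$. **Proposition.** Let $M$ be a space homeomorphic to a Sol sapphire and let $\tau:M\to M$ be a free involution (a continuous map with $\tau\circ\tau=\mathrm{id}$ and $\tau(x)\ne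 x$ for all $x\in M$). Then the triple $(M,\tau,\mathbb R^2)$ has the Borsuk–Ulam property: for every continuous map $f:M\to\mathbb R^2$ there is a point $x\in M$ with $f(x)=f(\tau(x))$. -/

import Mathlib

noncomputable section

namespace Sapphire

/-- The torus `ℝ²/ℤ²`. -/
abbrev Torus : Type := UnitAddCircle × UnitAddCircle

/-- The free involution `(x, y, z) ↦ (x + 1/2, -y, 1 - z)` of `T² × [0, 1]`; it preserves the
orientation. -/
def twist (p : Torus × unitInterval) : Torus × unitInterval :=
  ((p.1.1 + ((1 / 2 : ℝ) : UnitAddCircle), -p.1.2), unitInterval.symm p.2)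

/-- The orientable twisted `I`-bundle over the Klein bottle: the quotient of `T² × [0, 1]` by the
involution `twist`. The bundle projection is the map induced by `(x, y, z) ↦ (x, y)` onto the Klein
bottle `T² / ((x, y) ∼ (x + 1/2, -y))`. -/
def KI : Type := Quot fun p q : Torus × unitInterval => q = twist p

instance : TopologicalSpace KI :=
  inferInstanceAs (TopologicalSpace (Quot fun p q : Torus × unitInterval => q = twist p))

/-- The boundary of `KI` is the image of `T² × {0, 1}`, in which `twist` exchanges the two tori;
so it is a torus, parametrized by the map `p ↦ [p, 1]`. -/
def bdry (p : Torus) : KI := Quot.mk _ (p, 1)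

/-- The loop `t ↦ (x + t, y)`, `0 ≤ t ≤ 1`, at the point `(x, y)` of the torus. Under `bdry` it
becomes the square of the element `a` of
`π₁(KI) = ⟨a, b | a b a⁻¹ b = 1⟩`. -/
def loopα (p : Torus) : Path p p where
  toFun t := (p.1 + ((t : ℝ) : UnitAddCircle), p.2)
  continuous_toFun := by
    have h : Continuous fun t : unitInterval => ((t : ℝ) : UnitAddCircle) :=
      (AddCircle.continuous_mk' 1).comp continuous_subtype_val
    fun_prop
  source' := by simp
  target' := by simp [UnitAddCircle, AddCircle.coe_period]

/-- The loop `t ↦ (x, y + t)`, `0 ≤ t ≤ 1`, at the point `(x, y)` of the torus. Under `bdry` it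
becomes the element `b` of `π₁(KI) = ⟨a, b | a b a⁻¹ b = 1⟩`. -/
def loopβ (p : Torus) : Path p p where
  toFun t := (p.1, p.2 + ((t : ℝ) : UnitAddCircle))
  continuous_toFun := by
    have h : Continuous fun t : unitInterval => ((t : ℝ) : UnitAddCircle) :=
      (AddCircle.continuous_mk' 1).comp continuous_subtype_val
    fun_prop
  source' := by simp
  target' := by simp [UnitAddCircle, AddCircle.coe_period]

/-- The generator `α` of the fundamental group of the torus, at the base point `p`. -/
def genα (p : Torus) : FundamentalGroup Torus p :=
  FundamentalGroup.fromPath (Path.Homotopic.Quotient.mk (loopα p))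

/-- The generator `β` of the fundamental group of the torus, at the base point `p`. -/
def genβ (p : Torus) : FundamentalGroup Torus p :=
  FundamentalGroup.fromPath (Path.Homotopic.Quotient.mk (loopβ p))

/-- The homeomorphism `φ` of the torus induces on fundamental groups the isomorphism with matrix
`A = !![r, s; t, u]`, that is, `φ_#(α) = r α + s β` and `φ_#(β) = t α + u β`. (The groups are
abelian but written multiplicatively here.) -/
def Induces (φ : Torus ≃ₜ Torus) (A : GL (Fin 2) ℤ) : Prop :=
  FundamentalGroup.map (φ : C(Torus, Torus)) 0 (genα 0)
      = genα (φ 0) ^ (A.val 0 0) * genβ (φ 0) ^ (A.val 0 1) ∧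
  FundamentalGroup.map (φ : C(Torus, Torus)) 0 (genβ 0)
      = genα (φ 0) ^ (A.val 1 0) * genβ (φ 0) ^ (A.val 1 1)

/-- The sapphire `K₁I ∪_φ K₂I`: two copies of `KI` (`K₁I` on the left, `K₂I` on the right), each
boundary point `x` of `K₂I` being identified with the boundary point `φ x` of `K₁I`. -/
def Glued (φ : Torus ≃ₜ Torus) : Type :=
  Quot fun x y : KI ⊕ KI => ∃ p : Torus, x = Sum.inr (bdry p) ∧ y = Sum.inl (bdry (φ p))

instance (φ : Torus ≃ₜ Torus) : TopologicalSpace (Glued φ) :=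
  inferInstanceAs (TopologicalSpace (Quot fun x y : KI ⊕ KI =>
    ∃ p : Torus, x = Sum.inr (bdry p) ∧ y = Sum.inl (bdry (φ p))))

/-- `M` is (homeomorphic to) a Sol sapphire: a sapphire whose gluing homeomorphism induces a
matrix of `GL₂(ℤ)` all of whose entries are nonzero. -/
def IsSolSapphire (M : Type*) [TopologicalSpace M] : Prop :=
  ∃ (A : GL (Fin 2) ℤ) (φ : Torus ≃ₜ Torus),
    (∀ i j, A.val i j ≠ 0) ∧ Induces φ A ∧ Nonempty (M ≃ₜ Glued φ)

/-- `τ` is a free involution of the space `M`. -/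
structure IsFreeInvolution {M : Type*} [TopologicalSpace M] (τ : M → M) : Prop where
  continuous : Continuous τ
  involutive : Function.Involutive τ
  free : ∀ x, τ x ≠ x

/-- The triple `(M, τ, ℝⁿ)` has the Borsuk–Ulam property. -/
def BorsukUlamProperty {M : Type*} [TopologicalSpace M] (τ : M → M) (n : ℕ) : Prop :=
  ∀ f : M → EuclideanSpace ℝ (Fin n), Continuous f → ∃ x, f x = f (τ x)

end Sapphire

end

open unitInterval

namespace Sapphire

/-- Two real lifts of the same circle-valued map on a preconnected space differ by a constant. -/
theorem exists_eq_add_const_of_exp_eq {X : Type*} [TopologicalSpace X] [PreconnectedSpace X]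
    [Nonempty X] {u v : X → ℝ} (hu : Continuous u) (hv : Continuous v)
    (k : ℝ) (h : ∀ x, Circle.exp (u x) = Circle.exp (v x + k)) : ∃ c : ℝ, ∀ x, u x = v x + c := by
  obtain ⟨x₀⟩ := ‹Nonempty X›
  have hk : Circle.exp (u x₀ - v x₀) = Circle.exp k := by
    rw [Circle.exp_sub, h x₀, Circle.exp_add]; simp
  have key : u = fun x => v x + (u x₀ - v x₀) :=
    Circle.isCoveringMap_exp.eq_of_comp_eq hu (by fun_prop)
      (by ext1 x; simp only [Function.comp_apply]; rw [h x, Circle.exp_add, Circle.exp_add, hk])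
      x₀ (by simp)
  exact ⟨_, fun x => congrFun key x⟩

/-- The winding homomorphism of a circle-valued map: it sends a loop `γ` to the increment of a
real lift of the map along `γ`. -/
theorem exists_winding {X : Type*} [TopologicalSpace X] (f : C(X, Circle)) (x : X) :
    ∃ w : FundamentalGroup X x →* Multiplicative ℝ, ∀ (γ : Path x x) (Γ : C(I, ℝ)),
      (∀ t, Circle.exp (Γ t) = f (γ t)) →
      w (FundamentalGroup.fromPath (Path.Homotopic.Quotient.mk γ)) =
        Multiplicative.ofAdd (Γ 1 - Γ 0) := by
  have hp := Circle.isAddQuotientCoveringMap_exp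
  obtain ⟨e, he⟩ := hp.surjective (f x)
  let e' : Circle.exp ⁻¹' {f x} := ⟨e, he⟩
  let Z := AddSubgroup.zmultiples (2 * Real.pi)
  let W : FundamentalGroup X x →* (Multiplicative Z)ᵐᵒᵖ :=
    (hp.fundamentalGroupToMulOpposite e').comp (FundamentalGroup.map f x)
  refine ⟨(AddMonoidHom.toMultiplicative Z.subtype).comp
    ((MulOpposite.opMulEquiv (M := Multiplicative Z)).symm.toMonoidHom.comp W), fun γ Γ hΓ => ?_⟩
  have hΓ0 : Circle.exp (Γ 0) = f x := by simp [hΓ]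
  let Δ : C(I, ℝ) := ⟨fun t => Γ t - Γ 0 + e, by fun_prop⟩
  have hΔ : ∀ t, Circle.exp (Δ t) = f (γ t) := fun t => by
    simp only [Δ, ContinuousMap.coe_mk, Circle.exp_add, Circle.exp_sub, he, hΓ0, hΓ]
    exact div_mul_cancel _ _
  have hm : (hp.isCoveringMap.monodromy
      (Path.Homotopic.Quotient.mk (γ.map f.continuous)) e' : ℝ) = Δ 1 :=
    congr($((hp.isCoveringMap.eq_liftPath_iff' (Γ := Δ) (e := e)
      (γ := (γ.map f.continuous : C(I, Circle))) (by simp [he])).mpr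
      ⟨funext hΔ, by simp [Δ]⟩) 1).symm
  have hs := (hp.unop_fundamentalGroupToMulOpposite_smul (e := e')
    (γ := FundamentalGroup.fromPath (Path.Homotopic.Quotient.mk (γ.map f.continuous)))).trans hm
  refine congrArg Multiplicative.ofAdd (add_right_cancel (b := e) ?_)
  exact hs

/-- The projection `ℝ × ℝ × [0, 1] → T² × [0, 1]`. -/
noncomputable def proj : C((ℝ × ℝ) × I, Torus × I) where
  toFun v := (((v.1.1 : UnitAddCircle), (v.1.2 : UnitAddCircle)), v.2)
  continuous_toFun := by
    have h := AddCircle.continuous_mk' (1 : ℝ)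
    fun_prop

theorem isQuotientMap_proj : Topology.IsQuotientMap proj := by
  have h : IsOpenQuotientMap ((↑) : ℝ → UnitAddCircle) := QuotientAddGroup.isOpenQuotientMap_mk
  exact ((h.prodMap h).prodMap .id).isQuotientMap

theorem continuous_twist : Continuous twist := by
  unfold twist; fun_prop

theorem twist_twist (p : Torus × I) : twist (twist p) = p := by
  obtain ⟨⟨x, y⟩, z⟩ := p
  have : x + ((1 / 2 : ℝ) : UnitAddCircle) + ((1 / 2 : ℝ) : UnitAddCircle) = x := by
    rw [add_assoc, ← AddCircle.coe_add]; norm_num [AddCircle.coe_period]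
  simp only [twist, this, neg_neg, unitInterval.symm_symm]

theorem exists_lift_cover (G : C(Torus × I, Circle)) :
    ∃ L : (ℝ × ℝ) × ℝ → ℝ, Continuous L ∧
      ∀ x y z, Circle.exp (L ((x, y), z)) = G ((x, y), Set.projIcc 0 1 zero_le_one z) := by
  let F : C((ℝ × ℝ) × ℝ, Circle) :=
    ⟨fun v => G ((v.1.1, v.1.2), Set.projIcc 0 1 zero_le_one v.2), by
      have h := AddCircle.continuous_mk' (1 : ℝ)
      have h' : Continuous (Set.projIcc (0 : ℝ) 1 zero_le_one) := continuous_projIcc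
      fun_prop⟩
  obtain ⟨e, he⟩ := Circle.isAddQuotientCoveringMap_exp.surjective (F 0)
  obtain ⟨L, ⟨-, hL⟩, -⟩ := Circle.isCoveringMap_exp.existsUnique_continuousMap_lifts F 0 e he
  exact ⟨L, L.continuous, fun x y z => congrFun hL ((x, y), z)⟩

/-- The restriction of a map on `T² × [0, 1]` to the torus `z = 1`. -/
noncomputable def top (G : C(Torus × I, Circle)) : C(Torus, Circle) := ⟨fun p => G (p, 1), by fun_prop⟩

/-- A `twist`-invariant map `T² × [0, 1] → S¹` has a winding number only along `α`, and it lifts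
to `ℝ` as soon as that number vanishes. -/
theorem exists_period (G : C(Torus × I, Circle)) (hG : ∀ p, G (twist p) = G p) :
    ∃ a : ℝ,
      (∀ p : Torus, ∀ w : FundamentalGroup Torus p →* Multiplicative ℝ,
        (∀ (γ : Path p p) (Γ : C(I, ℝ)), (∀ t, Circle.exp (Γ t) = top G (γ t)) →
          w (FundamentalGroup.fromPath (Path.Homotopic.Quotient.mk γ)) =
            Multiplicative.ofAdd (Γ 1 - Γ 0)) →
        w (genα p) = Multiplicative.ofAdd a ∧ w (genβ p) = 1) ∧
      (a = 0 → ∃ h : Torus × I → ℝ, Continuous h ∧ ∀ p, Circle.exp (h p) = G p) := by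
  obtain ⟨L, hL, hLG⟩ := exists_lift_cover G
  obtain ⟨a, ha⟩ := exists_eq_add_const_of_exp_eq
    (u := fun v : (ℝ × ℝ) × ℝ => L ((v.1.1 + 1, v.1.2), v.2)) (v := L)
    (by fun_prop) hL 0 (by
      rintro ⟨⟨x, y⟩, z⟩
      rw [add_zero, hLG, hLG, AddCircle.coe_add, AddCircle.coe_period, add_zero])
  obtain ⟨b, hb⟩ := exists_eq_add_const_of_exp_eq
    (u := fun v : (ℝ × ℝ) × ℝ => L ((v.1.1, v.1.2 + 1), v.2)) (v := L)
    (by fun_prop) hL 0 (by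
      rintro ⟨⟨x, y⟩, z⟩
      rw [add_zero, hLG, hLG, AddCircle.coe_add, AddCircle.coe_period, add_zero])
  obtain ⟨c, hc⟩ := exists_eq_add_const_of_exp_eq
    (u := fun v : (ℝ × ℝ) × ℝ => L ((v.1.1 + 1 / 2, -v.1.2), 1 - v.2)) (v := L)
    (by fun_prop) hL 0 (by
      rintro ⟨⟨x, y⟩, z⟩
      rw [add_zero, hLG, hLG, ← hG ((x, y), _), AddCircle.coe_add, AddCircle.coe_neg]
      congr 2
      ext
      simp only [unitInterval.coe_symm_eq, Set.coe_projIcc]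
      grind)
  have hb0 : b = 0 := by
    have h1 := hc ((0, 0), 0)
    have h2 := hc ((0, 0 + 1), 0)
    have h3 := hb ((0, 0), 0)
    have h4 := hb ((0 + 1 / 2, -(0 + 1)), 1 - 0)
    norm_num at h1 h2 h3 h4
    linarith
  subst hb0
  refine ⟨a, fun p w hw => ?_, fun ha0 => ?_⟩
  · obtain ⟨p₁, p₂⟩ := p
    obtain ⟨x, rfl⟩ := QuotientAddGroup.mk_surjective p₁
    obtain ⟨y, rfl⟩ := QuotientAddGroup.mk_surjective p₂
    constructor
    · have h := hw (loopα _) ⟨fun t => L ((x + t, y), 1), by fun_prop⟩ fun t => by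
        simp only [ContinuousMap.coe_mk, hLG, AddCircle.coe_add, Set.projIcc_right]
        rfl
      refine h.trans (congrArg _ ?_)
      have := ha ((x, y), 1)
      simp at this ⊢
      linarith
    · have h := hw (loopβ _) ⟨fun t => L ((x, y + t), 1), by fun_prop⟩ fun t => by
        simp only [ContinuousMap.coe_mk, hLG, AddCircle.coe_add, Set.projIcc_right]
        rfl
      refine h.trans (congrArg _ ?_)
      have := hb ((x, y), 1)
      simp at this ⊢
      linarith
  · subst ha0
    have hx (y z : ℝ) : Function.Periodic (fun x => L ((x, y), z)) 1 := fun x => by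
      simpa using ha ((x, y), z)
    have hy (x z : ℝ) : Function.Periodic (fun y => L ((x, y), z)) 1 := fun y => by
      simpa using hb ((x, y), z)
    let L' : C((ℝ × ℝ) × I, ℝ) := ⟨fun v => L (v.1, v.2), by fun_prop⟩
    have hfac : Function.FactorsThrough L' proj := by
      rintro ⟨⟨x, y⟩, z⟩ ⟨⟨x', y'⟩, z'⟩ h
      simp only [proj, ContinuousMap.coe_mk, Prod.mk.injEq] at h
      obtain ⟨⟨h1, h2⟩, rfl⟩ := h
      have hx' (y z : ℝ) : L ((x, y), z) = L ((x', y), z) := congrArg (hx y z).lift h1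
      have hy' (x z : ℝ) : L ((x, y), z) = L ((x, y'), z) := congrArg (hy x z).lift h2
      exact (hx' _ _).trans (hy' _ _)
    let h := isQuotientMap_proj.lift L' hfac
    refine ⟨h, h.continuous, fun p => ?_⟩
    obtain ⟨v, rfl⟩ := isQuotientMap_proj.surjective p
    have hv : h (proj v) = L (v.1, v.2) :=
      DFunLike.congr_fun (isQuotientMap_proj.lift_comp L' hfac) v
    rw [hv]
    obtain ⟨⟨x, y⟩, z⟩ := v
    rw [hLG, Set.projIcc_val]; rfl

/-- A circle-valued map on `KI` lifts to `ℝ` if its pullback to `T² × [0, 1]` does. -/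
theorem exists_lift_KI (g : C(KI, Circle)) {h : Torus × I → ℝ} (hh : Continuous h)
    (hg : ∀ p, Circle.exp (h p) = g (Quot.mk _ p)) :
    ∃ H : KI → ℝ, Continuous H ∧ ∀ q, Circle.exp (H q) = g q := by
  obtain ⟨c, hc⟩ := exists_eq_add_const_of_exp_eq (hh.comp continuous_twist) hh 0 fun p => by
    simp only [Function.comp_apply, add_zero, hg]
    exact congrArg g (Quot.sound (r := fun p q : Torus × I => q = twist p) rfl).symm
  have hc0 (p : Torus × I) : h p = h (twist p) := by
    have h1 := hc p
    have h2 := hc (twist p)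
    simp only [Function.comp_apply, twist_twist] at h1 h2
    linarith
  refine ⟨Quot.lift h ?_, continuous_quot_lift _ hh, ?_⟩
  · rintro p _ rfl
    exact hc0 p
  · rintro ⟨p⟩
    exact hg p

/-- The inclusion of `K₁I` in the sapphire. -/
def left (φ : Torus ≃ₜ Torus) : C(KI, Glued φ) :=
  ⟨fun q => Quot.mk _ (Sum.inl q), continuous_quot_mk.comp continuous_inl⟩

/-- The inclusion of `K₂I` in the sapphire. -/
def right (φ : Torus ≃ₜ Torus) : C(KI, Glued φ) :=
  ⟨fun q => Quot.mk _ (Sum.inr q), continuous_quot_mk.comp continuous_inr⟩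

theorem right_bdry (φ : Torus ≃ₜ Torus) (p : Torus) :
    right φ (bdry p) = left φ (bdry (φ p)) :=
  Quot.sound ⟨p, rfl, rfl⟩

/-- The projection of `T² × [0, 1]` onto `KI`. -/
def mkKI : C(Torus × I, KI) := ⟨Quot.mk _, continuous_quot_mk⟩

theorem mkKI_twist (p : Torus × I) : mkKI (twist p) = mkKI p :=
  (Quot.sound (r := fun p q : Torus × I => q = twist p) rfl).symm

theorem continuous_bdry : Continuous bdry :=
  mkKI.continuous.comp (by fun_prop : Continuous fun p : Torus => (p, (1 : I)))

/-- Every circle-valued map on a sapphire lifts to `ℝ` if the gluing homeomorphism does not map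
`β` to a power of `β`. -/
theorem exists_lift_glued {φ : Torus ≃ₜ Torus} {A : GL (Fin 2) ℤ} (hA : A.val 1 0 ≠ 0)
    (hφ : Induces φ A) (g : C(Glued φ, Circle)) :
    ∃ H : Glued φ → ℝ, Continuous H ∧ ∀ x, Circle.exp (H x) = g x := by
  obtain ⟨a₁, hw₁, hl₁⟩ := exists_period (g.comp ((left φ).comp mkKI)) fun p => by
    simp [mkKI_twist]
  obtain ⟨a₂, hw₂, hl₂⟩ := exists_period (g.comp ((right φ).comp mkKI)) fun p => by
    simp [mkKI_twist]
  obtain ⟨w, hw⟩ := exists_winding (top (g.comp ((left φ).comp mkKI))) (φ 0)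
  obtain ⟨hα₁, hβ₁⟩ := hw₁ _ w hw
  obtain ⟨hα₂, hβ₂⟩ := hw₂ 0 (w.comp (FundamentalGroup.map (φ : C(Torus, Torus)) 0))
    fun γ Γ hΓ => hw (γ.map φ.continuous) Γ fun t =>
      (hΓ t).trans (congrArg g (right_bdry φ (γ t)))
  rw [MonoidHom.comp_apply, hφ.1, map_mul, map_zpow, map_zpow, hα₁, hβ₁, one_zpow, mul_one,
    ← ofAdd_zsmul] at hα₂
  rw [MonoidHom.comp_apply, hφ.2, map_mul, map_zpow, map_zpow, hα₁, hβ₁, one_zpow, mul_one,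
    ← ofAdd_zsmul, ofAdd_eq_one] at hβ₂
  have ha₁ : a₁ = 0 := (smul_eq_zero.1 hβ₂).resolve_left hA
  have ha₂ : a₂ = 0 := by simpa [ha₁] using hα₂.symm
  obtain ⟨h₁, hc₁, he₁⟩ := hl₁ ha₁
  obtain ⟨h₂, hc₂, he₂⟩ := hl₂ ha₂
  obtain ⟨H₁, hC₁, hE₁⟩ := exists_lift_KI (g.comp (left φ)) hc₁ he₁
  obtain ⟨H₂, hC₂, hE₂⟩ := exists_lift_KI (g.comp (right φ)) hc₂ he₂
  obtain ⟨c, hc⟩ := exists_eq_add_const_of_exp_eq (u := fun p => H₂ (bdry p))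
    (v := fun p => H₁ (bdry (φ p))) (hC₂.comp continuous_bdry)
    (hC₁.comp (continuous_bdry.comp φ.continuous)) 0 fun p => by
      rw [add_zero, hE₁, hE₂]
      exact congrArg g (right_bdry φ p)
  have hc1 : Circle.exp c = 1 := by
    have h := hE₂ (bdry 0)
    rw [hc 0, Circle.exp_add, hE₁] at h
    refine mul_left_cancel (h.trans ?_)
    rw [mul_one]
    exact congrArg g (right_bdry φ 0)
  refine ⟨Quot.lift (Sum.elim (fun q => H₁ q + c) H₂) ?_, continuous_quot_lift _ (by fun_prop), ?_⟩
  · rintro _ _ ⟨p, rfl, rfl⟩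
    exact hc p
  · rintro ⟨q | q⟩
    · change Circle.exp (H₁ q + c) = _
      rw [Circle.exp_add, hc1, mul_one, hE₁]; rfl
    · exact hE₂ q

instance : PreconnectedSpace KI :=
  Quot.mk_surjective.denseRange.preconnectedSpace mkKI.continuous

instance (φ : Torus ≃ₜ Torus) : PreconnectedSpace (Glued φ) := by
  refine ⟨?_⟩
  have h : (Set.univ : Set (Glued φ)) = Set.range (left φ) ∪ Set.range (right φ) := by
    refine (Set.eq_univ_of_forall ?_).symm
    rintro ⟨q | q⟩
    exacts [Or.inl ⟨q, rfl⟩, Or.inr ⟨q, rfl⟩]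
  rw [h]
  exact (isPreconnected_range (left φ).continuous).union (right φ (bdry 0))
    ⟨_, (right_bdry φ 0).symm⟩ ⟨_, rfl⟩ (isPreconnected_range (right φ).continuous)

/-- A free involution of a connected space on which all circle-valued maps lift to `ℝ` has the
Borsuk–Ulam property for maps to the plane. -/
theorem borsukUlamProperty_two {M : Type*} [TopologicalSpace M] [PreconnectedSpace M] [Nonempty M]
    (hlift : ∀ g : C(M, Circle), ∃ H : M → ℝ, Continuous H ∧ ∀ x, Circle.exp (H x) = g x)
    {τ : M → M} (hτ : IsFreeInvolution τ) : BorsukUlamProperty τ 2 := by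
  intro f hf
  by_contra! hne
  have hτc := hτ.continuous
  let d (x : M) : ℂ := ⟨f x 0 - f (τ x) 0, f x 1 - f (τ x) 1⟩
  have hd : Continuous d := by
    have : d = fun x => ((f x 0 - f (τ x) 0 : ℝ) : ℂ) + ((f x 1 - f (τ x) 1 : ℝ) : ℂ) * Complex.I :=
      funext fun x => Complex.mk_eq_add_mul_I _ _
    rw [this]; fun_prop
  have hd0 (x : M) : d x ≠ 0 := fun h => hne x <| by
    ext i
    fin_cases i
    · exact sub_eq_zero.1 congr(Complex.re $h)
    · exact sub_eq_zero.1 congr(Complex.im $h)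
  have hdτ (x : M) : d (τ x) = -d x := by
    apply Complex.ext <;> simp [d, hτ.involutive x]
  have hg1 (x : M) : d x / (‖d x‖ : ℂ) ∈ Submonoid.unitSphere ℂ := by
    simp [Submonoid.unitSphere, hd0 x]
  let g : C(M, Circle) :=
    ⟨fun x => ⟨d x / ‖d x‖, hg1 x⟩,
      Continuous.subtype_mk (hd.div (by fun_prop) (by simpa using hd0)) hg1⟩
  obtain ⟨H, hH, hHg⟩ := hlift g
  have hg (x : M) : g (τ x) = g x * Circle.exp Real.pi := by
    apply Circle.ext
    rw [Circle.coe_mul, Circle.coe_exp, Complex.exp_pi_mul_I]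
    change d (τ x) / (‖d (τ x)‖ : ℂ) = d x / (‖d x‖ : ℂ) * -1
    rw [hdτ, norm_neg]
    ring
  obtain ⟨c, hc⟩ := exists_eq_add_const_of_exp_eq (hH.comp hτc) hH Real.pi fun x => by
    rw [Circle.exp_add, Function.comp_apply, hHg, hHg, hg]
  obtain ⟨x⟩ := ‹Nonempty M›
  have h1 := hc x
  have h2 := hc (τ x)
  simp only [Function.comp_apply, hτ.involutive x] at h1 h2
  have h3 := hg x
  rw [← hHg, ← hHg, show H (τ x) = H x by linarith] at h3
  have h4 := congr(($(left_eq_mul.1 h3) : ℂ))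
  norm_num at h4

end Sapphire

theorem mainTheorem3 {M : Type*} [TopologicalSpace M] (hM : Sapphire.IsSolSapphire M)
    (τ : M → M) (hτ : Sapphire.IsFreeInvolution τ) :
    Sapphire.BorsukUlamProperty τ 2 := by
  obtain ⟨A, φ, hA, hφ, ⟨e⟩⟩ := hM
  have : PreconnectedSpace M := e.symm.surjective.denseRange.preconnectedSpace e.symm.continuous
  have : Nonempty M := ⟨e.symm (Sapphire.left φ (Sapphire.bdry 0))⟩
  refine Sapphire.borsukUlamProperty_two (fun g => ?_) hτ
  obtain ⟨H, hH, hHg⟩ := Sapphire.exists_lift_glued (hA 1 0) hφ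
    (g.comp (e.symm : C(Sapphire.Glued φ, M)))
  exact ⟨H ∘ e, hH.comp e.continuous, fun x => by simp [hHg]⟩
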